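/- Let $N=2^n$, $[N]=\{0,\dots,N-1\}$, $\omega_N=e^{2\pi i/N}$ and $0<\alpha<\tfrac12$. For a permutation $f$ of $[N]$, the phase oracle of $f$ is the unitary $\overline U_f|x,z\rangle=\omega_N^{f^z(x)}|x,z\rangle$ on $\mathbb C^{2N}$ ($x\in[N]$, $z\in\{\pm1\}$). For a nonempty set $F$ of permutations of $[N]$, one query to the randomized phase oracle presenting $F$ is the channel $\overline{\mathcal O}_F[\rho]=\frac1{|F|}\sum_{f\in F}\overline U_f\,\rho\,\overline U_f^\dagger$. For $V\subseteq[N]$ let $T_V$ be the set of permutations of $[N]$ that map $V$ onto itself; thus $T_\varnothing$ is the set of all permutations. In the randomized hidden-subset problem, the YES instances are the $\overline{\mathcal O}_{T_V}$ with $|V|=v(n)$, where $v(n)$ is $N^\alpha$ rounded to an integer ($|v(n)-N^\alpha|<1$), and the only NO instance is $\overline{\mathcal O}_{T_\varnothing}$. A $k$-query algorithm with $w$ additional qubits acts on the oracle register, a workspace of $w$ qubits, and a memory of arbitrary finite dimension. From a starting state it alternates arbitrary unitaries of the whole system with $k$ queries, and then measures a POVM $\{E,\mathbb I-E\}$, accepting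 on $E$. It is required that before each query the state be separable between (oracle register and workspace) and memory, so that queries are entangled with at most $w$ additional qubits; without memory this is no restriction. A verifier is such an algorithm with a set of admissible starting states, namely those to which the admissible witnesses, of any type and size, lead; the requirement has to hold on all instances and all admissible starting states. A verifier decides the problem with gap $\varepsilon$ if for every $V$ with $|V|=v(n)$ some admissible starting state is accepted under $\overline{\mathcal O}_{T_V}$ with probability at least $\varepsilon$ higher than any admissible starting state is accepted under $\overline{\mathcal O}_{T_\varnothing}$. Theorem. Let $w(n)=o(n)$ and let $v(n)$ be as above. (1) There is a constant $c>0$, depending only on $\alpha$, such that for all but a vanishing fraction (as $n\to\infty$) of the sets $V\subseteq[N]$ with $|V|=v(n)$, the following holds. Every algorithm with at most $w(n)$ additional qubits and every starting state, whose acceptance probabilities under $\overline{\mathcal O}_{T_V}$ and $\overline{\mathcal O}_{T_\varnothing}$ differ by $\varepsilon$, make at least $c\,\varepsilon\,\min(N^{\alpha/4},N^{1/2-\alpha})$ queries. In particular $\Omega(\min(N^{\alpha/4},N^{1/2-\alpha}))$ queries are needed for a constant advantage. (2) No such verifier decides the problem efficiently, with any witness: for all polynomials $p$ and $q\neq0$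 with nonnegative integer coefficients and all sufficiently large $n$, no verifier with at most $w(n)$ additional qubits and at most $p(n)$ queries decides the problem with gap $1/q(n)$. -/

import Mathlib

open scoped Kronecker ComplexOrder

noncomputable section

namespace PhaseOracle

/-- The oracle register: basis vectors `|x, z⟩` with `x ∈ [N]` and `z ∈ {1, -1}`. -/
abbrev OracleReg (N : ℕ) : Type := Fin N × ℤˣ

/-- The whole system: the oracle register, `w` workspace qubits that a query may be entangled
with, and a further `d`-dimensional memory, `d` arbitrary (for instance, the part of a witness
that is not entangled with the query). -/
abbrev Reg (N w d : ℕ) : Type := (OracleReg N × Fin (2 ^ w)) × Fin d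

/-- The primitive root of unity `exp (2 π i / N)`. -/
def omega (N : ℕ) : ℂ := Complex.exp (2 * Real.pi * Complex.I / N)

/-- The phase oracle presenting the permutation `f`, which gives access to `f` and its inverse:
`|x, z⟩ ↦ ω_N ^ (f ^ z) (x) |x, z⟩`. -/
def phaseOracle {N : ℕ} (f : Equiv.Perm (Fin N)) : Matrix (OracleReg N) (OracleReg N) ℂ :=
  Matrix.diagonal fun p => omega N ^ (((f ^ (p.2 : ℤ)) p.1 : Fin N) : ℕ)

/-- The phase oracle acting on the oracle register of the whole system. -/
def phaseOracleExt {N : ℕ} (w d : ℕ) (f : Equiv.Perm (Fin N)) :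
    Matrix (Reg N w d) (Reg N w d) ℂ :=
  (phaseOracle f ⊗ₖ (1 : Matrix (Fin (2 ^ w)) (Fin (2 ^ w)) ℂ)) ⊗ₖ (1 : Matrix (Fin d) (Fin d) ℂ)

/-- One query to the randomized phase oracle presenting `F`: the average over `f ∈ F` of
conjugation by the phase oracle of `f` (with fresh randomness at each query). -/
def randomizedQuery {N w d : ℕ} (F : Finset (Equiv.Perm (Fin N)))
    (ρ : Matrix (Reg N w d) (Reg N w d) ℂ) : Matrix (Reg N w d) (Reg N w d) ℂ :=
  (F.card : ℂ)⁻¹ • ∑ f ∈ F, phaseOracleExt w d f * ρ * (phaseOracleExt w d f).conjTranspose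

/-- `T_V`: the permutations of `[N]` that map `V` to itself and its complement to itself. -/
def stabilizing {N : ℕ} (V : Finset (Fin N)) : Finset (Equiv.Perm (Fin N)) :=
  Finset.univ.filter fun f => ∀ x, x ∈ V ↔ f x ∈ V

/-- `T_∅` is the set of all permutations. -/
theorem stabilizing_empty (N : ℕ) : stabilizing (∅ : Finset (Fin N)) = Finset.univ := by
  simp [stabilizing]

/-- Density matrices. -/
def IsDensity {ι : Type} [Fintype ι] [DecidableEq ι] (ρ : Matrix ι ι ℂ) : Prop :=
  ρ.PosSemidef ∧ ρ.trace = 1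

/-- `ρ` is separable (not entangled) with respect to the bipartition `ι | κ`: it is a finite sum
of tensor products of positive semidefinite matrices. -/
def IsSeparable {ι κ : Type} [Fintype ι] [Fintype κ] (ρ : Matrix (ι × κ) (ι × κ) ℂ) : Prop :=
  ∃ (r : ℕ) (σ : Fin r → Matrix ι ι ℂ) (τ : Fin r → Matrix κ κ ℂ),
    (∀ j, (σ j).PosSemidef) ∧ (∀ j, (τ j).PosSemidef) ∧ ρ = ∑ j, σ j ⊗ₖ τ j

/-- A query algorithm: it applies `U 0`, queries, applies `U 1`, queries, …, applies
`U (queries - 1)`, queries, and measures the POVM `{E, 1 - E}`, accepting on `E`. -/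
structure QueryAlgorithm (N w d : ℕ) where
  queries : ℕ
  U : ℕ → Matrix.unitaryGroup (Reg N w d) ℂ
  E : Matrix (Reg N w d) (Reg N w d) ℂ
  E_nonneg : E.PosSemidef
  E_le_one : (1 - E).PosSemidef

namespace QueryAlgorithm

variable {N w d : ℕ}

/-- The state to which the unitary `U i` leads from `σ`. -/
def evolve (A : QueryAlgorithm N w d) (i : ℕ) (σ : Matrix (Reg N w d) (Reg N w d) ℂ) :
    Matrix (Reg N w d) (Reg N w d) ℂ :=
  (A.U i : Matrix (Reg N w d) (Reg N w d) ℂ) * σ *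
    (A.U i : Matrix (Reg N w d) (Reg N w d) ℂ).conjTranspose

/-- The state right after the `i`-th query, when the oracle presents `F` and the starting state
is `ρ`. -/
def state (A : QueryAlgorithm N w d) (F : Finset (Equiv.Perm (Fin N)))
    (ρ : Matrix (Reg N w d) (Reg N w d) ℂ) : ℕ → Matrix (Reg N w d) (Reg N w d) ℂ
  | 0 => ρ
  | i + 1 => randomizedQuery F (A.evolve i (A.state F ρ i))

/-- The probability that the algorithm accepts. -/
def acceptProb (A : QueryAlgorithm N w d) (F : Finset (Equiv.Perm (Fin N)))
    (ρ : Matrix (Reg N w d) (Reg N w d) ℂ) : ℝ :=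
  (A.E * A.state F ρ A.queries).trace.re

/-- At each query, the oracle register is entangled with the `w` workspace qubits at most:
the oracle register and the workspace together are not entangled with the memory. This always
holds when there is no memory, that is `d = 1`. -/
def EntanglesOnlyWorkspace (A : QueryAlgorithm N w d) (F : Finset (Equiv.Perm (Fin N)))
    (ρ : Matrix (Reg N w d) (Reg N w d) ℂ) : Prop :=
  ∀ i < A.queries, IsSeparable (A.evolve i (A.state F ρ i))

end QueryAlgorithm

/-- Whatever its starting state, an algorithm that entangles its queries with at most `w` additional
qubits and tells the YES instance `T_V` from the NO instance `T_∅` with advantage `ε` makes at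
least `ε * b` queries. -/
def NeedsQueries {N : ℕ} (w : ℕ) (V : Finset (Fin N)) (b : ℝ) : Prop :=
  ∀ (d : ℕ) (A : QueryAlgorithm N w d) (ρ : Matrix (Reg N w d) (Reg N w d) ℂ), IsDensity ρ →
    A.EntanglesOnlyWorkspace (stabilizing V) ρ → A.EntanglesOnlyWorkspace (stabilizing ∅) ρ →
    |A.acceptProb (stabilizing V) ρ - A.acceptProb (stabilizing ∅) ρ| * b ≤ A.queries

open Classical in
/-- The fraction, among the subsets `V` of `[N]` of size `m`, of those with `NeedsQueries w V b`. -/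
def hardFraction (N w m : ℕ) (b : ℝ) : ℝ :=
  (((Finset.univ : Finset (Fin N)).powersetCard m).filter fun V => NeedsQueries w V b).card /
    ((Finset.univ : Finset (Fin N)).powersetCard m).card

/-- A verifier for the hidden subset problem with subsets of size `m`. The admissible witnesses,
of any type and size, enter through the set `starts` of the starting states to which they lead
(so a classical witness, for instance, leads to a starting state that contains it as a basis
state). On all instances and witnesses, the queries are entangled with at most `w` additional
qubits. -/
structure Verifier (N w m : ℕ) where
  d : ℕ
  alg : QueryAlgorithm N w d
  starts : Set (Matrix (Reg N w d) (Reg N w d) ℂ)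
  isDensity : ∀ ρ ∈ starts, IsDensity ρ
  yes_entangles : ∀ V : Finset (Fin N), V.card = m → ∀ ρ ∈ starts,
    alg.EntanglesOnlyWorkspace (stabilizing V) ρ
  no_entangles : ∀ ρ ∈ starts, alg.EntanglesOnlyWorkspace (stabilizing ∅) ρ

/-- The verifier decides the problem with gap `ε`: each YES instance has a witness that is accepted
with a probability higher by at least `ε` than that of any witness in the NO instance. -/
def Verifier.Decides {N w m : ℕ} (P : Verifier N w m) (ε : ℝ) : Prop :=
  ∀ V : Finset (Fin N), V.card = m → ∃ ρ ∈ P.starts, ∀ ρ' ∈ P.starts,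
    P.alg.acceptProb (stabilizing ∅) ρ' + ε ≤ P.alg.acceptProb (stabilizing V) ρ

end PhaseOracle

end

/-! A phase oracle is diagonal, so a randomized query multiplies the state entrywise by the
correlation matrix of the phases `phase f p` for `f` uniform in `F`, whatever registers accompany
the query. For `T_∅` and for most `T_V` this matrix is close to the identity: either query almost
completely dephases the oracle register, so a single query barely separates the two instances, and
by a hybrid argument the errors of successive queries only add up.

Small entries alone would not make a small Schur multiplier; structure is needed. Split the indices
by the sign `z` and the side (`V` or its complement) of `x`. On each of the 16 pairs of blocks, the
deviation from the identity is a combination of the all-ones matrix, the identity and rank one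
matrices (`queryMatrix_of_ne_block`, `queryMatrix_of_ne`, `queryMatrix_of_sign_ne`). Its
coefficients are small when each nonempty side, of size `m` and phase sum `S`, has `1/m` and
`(|S|+1)^2/m^2` small. This is `Balanced`, and `Balanced.schurBound` turns it into a bound on the
multiplier.

The phases sum to zero over `[N]`, so the two sides have opposite sums. Over random `V` of size `m`,
the mean of `|S|^2` is at most `m` (`sum_norm_sq_sum_chi_le`), so by Markov `|S|^2 ≤ m√m` outside a
fraction `1/√m` of the sets. The error per query is then `O(1/√m)`, which forces a number of queries
of order `ε√m`, that is `ε N^(α/2)`. For a verifier, one such `V` suffices: its YES witness is also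
run on the NO instance. -/

noncomputable section

namespace PhaseOracle

open Matrix

/-! ### Schur multipliers tested against effects -/

open scoped MatrixOrder Matrix.Norms.L2Operator in
/-- The trace of a product of positive semidefinite matrices is nonnegative. -/
theorem trace_mul_nonneg {κ : Type} [Fintype κ] [DecidableEq κ] {A B : Matrix κ κ ℂ}
    (hA : A.PosSemidef) (hB : B.PosSemidef) : 0 ≤ (A * B).trace := by
  obtain ⟨C, rfl⟩ := CStarAlgebra.nonneg_iff_eq_star_mul_self.mp hB.nonneg
  rw [← Matrix.mul_assoc, Matrix.trace_mul_comm, ← Matrix.mul_assoc]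
  exact (hA.mul_mul_conjTranspose_same C).trace_nonneg

theorem norm_trace_effect_mul_le {κ : Type} [Fintype κ] [DecidableEq κ] {E ρ : Matrix κ κ ℂ}
    (hE : E.PosSemidef) (hE' : (1 - E).PosSemidef) (hρ : ρ.PosSemidef) :
    ‖(E * ρ).trace‖ ≤ ρ.trace.re := by
  have h1 := trace_mul_nonneg hE hρ
  have h2 := trace_mul_nonneg hE' hρ
  rw [Matrix.sub_mul, Matrix.trace_sub, Matrix.one_mul] at h2
  rw [← Complex.abs_re_eq_norm.mpr (Complex.le_def.mp h1).2.symm,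
    abs_of_nonneg (Complex.le_def.mp h1).1]
  have := (Complex.le_def.mp h2).1
  simp at this
  exact this

/-- Schur multiplication by `M`, after any amplification, maps a positive semidefinite `ρ` to a
matrix whose pairing with any effect is at most `c * tr ρ`. -/
def SchurBound {ι : Type} (M : Matrix ι ι ℂ) (c : ℝ) : Prop :=
  ∀ (κ : Type) [Fintype κ] [DecidableEq κ] (π : κ → ι) (ρ E : Matrix κ κ ℂ),
    ρ.PosSemidef → E.PosSemidef → (1 - E).PosSemidef →
      ‖(E * (M.submatrix π π ⊙ ρ)).trace‖ ≤ c * ρ.trace.re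

namespace SchurBound

variable {ι : Type}

/-- By the Schur product theorem the product stays positive semidefinite, and the unit diagonal
preserves the trace. -/
theorem of_posSemidef {M : Matrix ι ι ℂ} (hM : M.PosSemidef) (h1 : ∀ p, M p p = 1) :
    SchurBound M 1 := by
  intro κ _ _ π ρ E hρ hE hE'
  refine (norm_trace_effect_mul_le hE hE' ((hM.submatrix π).hadamard hρ)).trans ?_
  simp [Matrix.trace, h1]

theorem const_one : SchurBound (Matrix.of fun _ _ : ι => (1 : ℂ)) 1 := by
  intro κ _ _ π ρ E hρ hE hE'
  have : (Matrix.of fun _ _ : ι => (1 : ℂ)).submatrix π π ⊙ ρ = ρ := by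
    ext; simp
  rw [this, one_mul]
  exact norm_trace_effect_mul_le hE hE' hρ

theorem one [DecidableEq ι] : SchurBound (1 : Matrix ι ι ℂ) 1 :=
  of_posSemidef Matrix.PosSemidef.one (by simp)

theorem zero : SchurBound (0 : Matrix ι ι ℂ) 0 := by
  intro κ _ _ π ρ E _ _ _
  simp

theorem add {M M' : Matrix ι ι ℂ} {c c' : ℝ} (h : SchurBound M c) (h' : SchurBound M' c') :
    SchurBound (M + M') (c + c') := by
  intro κ _ _ π ρ E hρ hE hE'
  rw [Matrix.submatrix_add, Pi.add_apply, Pi.add_apply, Matrix.add_hadamard, Matrix.mul_add,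
    Matrix.trace_add, add_mul]
  exact (norm_add_le _ _).trans (add_le_add (h κ π ρ E hρ hE hE') (h' κ π ρ E hρ hE hE'))

theorem smul {M : Matrix ι ι ℂ} {c : ℝ} (h : SchurBound M c) (a : ℂ) :
    SchurBound (a • M) (‖a‖ * c) := by
  intro κ _ _ π ρ E hρ hE hE'
  rw [Matrix.submatrix_smul, Pi.smul_apply, Pi.smul_apply, Matrix.smul_hadamard, Matrix.mul_smul,
    Matrix.trace_smul, norm_smul, mul_assoc]
  exact mul_le_mul_of_nonneg_left (h κ π ρ E hρ hE hE') (norm_nonneg _)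

theorem sub {M M' : Matrix ι ι ℂ} {c c' : ℝ} (h : SchurBound M c) (h' : SchurBound M' c') :
    SchurBound (M - M') (c + c') := by
  have := h.add (h'.smul (-1))
  simpa [sub_eq_add_neg] using this

theorem mono {M : Matrix ι ι ℂ} {c c' : ℝ} (h : SchurBound M c) (hc : c ≤ c') :
    SchurBound M c' := by
  intro κ _ _ π ρ E hρ hE hE'
  exact (h κ π ρ E hρ hE hE').trans
    (mul_le_mul_of_nonneg_right hc (Complex.le_def.mp hρ.trace_nonneg).1)

theorem sum {β : Type} (s : Finset β) {M : β → Matrix ι ι ℂ} {c : β → ℝ}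
    (h : ∀ b ∈ s, SchurBound (M b) (c b)) : SchurBound (∑ b ∈ s, M b) (∑ b ∈ s, c b) := by
  classical
  induction s using Finset.induction_on with
  | empty => simpa using zero
  | insert a s ha ih =>
    rw [Finset.sum_insert ha, Finset.sum_insert ha]
    exact (h a (Finset.mem_insert_self a s)).add
      (ih fun b hb => h b (Finset.mem_insert_of_mem hb))

/-- Schur multiplication by a further rank one matrix, by polarization. -/
theorem mul_rankOne {M : Matrix ι ι ℂ} {c : ℝ} (h : SchurBound M c) (hc : 0 ≤ c) {l r : ι → ℂ}
    (hl : ∀ p, ‖l p‖ ≤ 1) (hr : ∀ p, ‖r p‖ ≤ 1) :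
    SchurBound (Matrix.of fun p q => l p * M p q * star (r q)) (4 * c) := by
  intro κ _ _ π ρ E hρ hE hE'
  -- Polarization: `l ρ r*` is a quarter of the sum of `u (l + u r) ρ (l + u r)*` over the fourth
  -- roots of unity `u`. Each term is a positive matrix of trace at most `4 tr ρ`, since `|l + u r|
  -- ≤ 2`.
  let D : ℂ → κ → ℂ := fun u k => l (π k) + u * r (π k)
  let R : ℂ → Matrix κ κ ℂ := fun u => diagonal (D u) * ρ * (diagonal (D u))ᴴ
  have hR : ∀ u, (R u).PosSemidef := fun u => hρ.mul_mul_conjTranspose_same _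
  have hRa : ∀ u i j, R u i j = D u i * ρ i j * star (D u j) := fun u i j => by
    simp [R, Matrix.diagonal_conjTranspose]
  have htr : ∀ u : ℂ, ‖u‖ = 1 → (R u).trace.re ≤ 4 * ρ.trace.re := by
    intro u hu
    rw [Matrix.trace, Matrix.trace, Complex.re_sum, Complex.re_sum, Finset.mul_sum]
    refine Finset.sum_le_sum fun k _ => ?_
    rw [Matrix.diag_apply, Matrix.diag_apply, hRa]
    have h2 : ‖D u k‖ ≤ 2 := by
      refine (norm_add_le _ _).trans ?_
      rw [norm_mul, hu, one_mul]
      linarith [hl (π k), hr (π k)]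
    have h0 : 0 ≤ (ρ k k).re := (Complex.le_def.mp (hρ.diag_nonneg (i := k))).1
    have : D u k * ρ k k * star (D u k) = ((‖D u k‖ ^ 2 : ℝ) : ℂ) * ρ k k := by
      rw [mul_right_comm]
      congr 1
      have := Complex.mul_conj' (D u k)
      simpa using this
    rw [this, Complex.re_ofReal_mul]
    have : ‖D u k‖ ^ 2 ≤ 2 ^ 2 := pow_le_pow_left₀ (norm_nonneg _) h2 2
    nlinarith
  have key : (Matrix.of fun p q => l p * M p q * star (r q)).submatrix π π ⊙ ρ =
      (1 / 4 : ℂ) • (M.submatrix π π ⊙ R 1 + Complex.I • (M.submatrix π π ⊙ R Complex.I)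
        + (-1 : ℂ) • (M.submatrix π π ⊙ R (-1))
        + (-Complex.I) • (M.submatrix π π ⊙ R (-Complex.I))) := by
    ext i j
    simp only [Matrix.hadamard_apply, Matrix.submatrix_apply, Matrix.of_apply, Matrix.smul_apply,
      Matrix.add_apply, hRa, D, smul_eq_mul, star_add, star_mul', star_neg, star_one,
      Complex.star_def, Complex.conj_I]
    have hI : Complex.I ^ 2 = -1 := Complex.I_sq
    ring_nf
    simp only [hI]
    ring
  have hb : ∀ u : ℂ, ‖u‖ = 1 →
      ‖u * (E * (M.submatrix π π ⊙ R u)).trace‖ ≤ c * (4 * ρ.trace.re) := by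
    intro u hu
    rw [norm_mul, hu, one_mul]
    exact (h κ π (R u) E (hR u) hE hE').trans (mul_le_mul_of_nonneg_left (htr u hu) hc)
  rw [key, Matrix.mul_smul, Matrix.trace_smul, Matrix.mul_add, Matrix.mul_add, Matrix.mul_add,
    Matrix.trace_add, Matrix.trace_add, Matrix.trace_add, Matrix.mul_smul, Matrix.mul_smul,
    Matrix.mul_smul, Matrix.trace_smul, Matrix.trace_smul, Matrix.trace_smul, norm_smul]
  have h1 := hb 1 (by simp)
  have h2 := hb Complex.I (by simp)
  have h3 := hb (-1) (by simp)
  have h4 := hb (-Complex.I) (by simp)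
  rw [one_mul] at h1
  simp only [smul_eq_mul]
  have := (norm_add₄_le (a := (E * (M.submatrix π π ⊙ R 1)).trace)
    (b := Complex.I * (E * (M.submatrix π π ⊙ R Complex.I)).trace)
    (c := -1 * (E * (M.submatrix π π ⊙ R (-1))).trace)
    (d := -Complex.I * (E * (M.submatrix π π ⊙ R (-Complex.I))).trace))
  have h14 : ‖(1 / 4 : ℂ)‖ = 1 / 4 := by norm_num
  rw [h14]
  linarith

theorem rankOne {l r : ι → ℂ} (hl : ∀ p, ‖l p‖ ≤ 1) (hr : ∀ p, ‖r p‖ ≤ 1) :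
    SchurBound (Matrix.of fun p q => l p * star (r q)) 4 := by
  have := const_one.mul_rankOne zero_le_one hl hr
  simpa using this

/-- A matrix that coincides on each block with a Schur bounded matrix is Schur bounded. -/
theorem of_blocks {β : Type} [Fintype β] [DecidableEq β] (b : ι → β) {M : Matrix ι ι ℂ} {c : ℝ}
    (hc : 0 ≤ c) (h : ∀ s t, ∃ M' : Matrix ι ι ℂ, SchurBound M' c ∧
      ∀ p q, b p = s → b q = t → M p q = M' p q) :
    SchurBound M (Fintype.card β * Fintype.card β * (4 * c)) := by
  choose B hB hMB using h
  -- Cutting out a block is a rank one multiplication by indicators, hence the factor 4 for each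
  -- pair of blocks.
  have hM : M = ∑ s, ∑ t, Matrix.of fun p q =>
      (if b p = s then (1 : ℂ) else 0) * B s t p q * star (if b q = t then (1 : ℂ) else 0) := by
    ext p q
    rw [Matrix.sum_apply, Finset.sum_eq_single (b p), Matrix.sum_apply,
      Finset.sum_eq_single (b q)]
    · simpa using hMB _ _ p q rfl rfl
    · intro t _ ht
      simp [ht.symm]
    · simp
    · intro s _ hs
      simp [Matrix.sum_apply, hs.symm]
    · simp
  rw [hM]
  refine (sum _ fun s _ => sum _ fun t _ => (hB s t).mul_rankOne hc ?_ ?_).mono ?_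
  · intro p; split_ifs <;> simp
  · intro p; split_ifs <;> simp
  · simp [mul_assoc]

end SchurBound

/-! ### A query as a Schur multiplication -/

/-- The diagonal of the phase oracle. -/
def phase {N : ℕ} (f : Equiv.Perm (Fin N)) (p : OracleReg N) : ℂ :=
  omega N ^ (((f ^ (p.2 : ℤ)) p.1 : Fin N) : ℕ)

theorem norm_omega (N : ℕ) : ‖omega N‖ = 1 := by
  have : omega N = Complex.exp ((2 * Real.pi / N : ℝ) * Complex.I) := by
    rw [omega]; congr 1; push_cast; ring
  rw [this, Complex.norm_exp_ofReal_mul_I]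

theorem norm_phase {N : ℕ} (f : Equiv.Perm (Fin N)) (p : OracleReg N) : ‖phase f p‖ = 1 := by
  rw [phase, norm_pow, norm_omega, one_pow]

/-- The matrix by which a query acts as a Schur multiplication. -/
def queryMatrix {N : ℕ} (F : Finset (Equiv.Perm (Fin N))) :
    Matrix (OracleReg N) (OracleReg N) ℂ :=
  (F.card : ℂ)⁻¹ • ∑ f ∈ F, Matrix.of fun p q => phase f p * star (phase f q)

theorem phaseOracleExt_eq {N : ℕ} (w d : ℕ) (f : Equiv.Perm (Fin N)) :
    phaseOracleExt w d f = diagonal fun p => phase f p.1.1 := by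
  rw [phaseOracleExt, phaseOracle, ← Matrix.diagonal_one, Matrix.diagonal_kronecker_diagonal,
    ← Matrix.diagonal_one, Matrix.diagonal_kronecker_diagonal]
  simp [phase]

theorem randomizedQuery_eq {N w d : ℕ} (F : Finset (Equiv.Perm (Fin N)))
    (ρ : Matrix (Reg N w d) (Reg N w d) ℂ) :
    randomizedQuery F ρ =
      (queryMatrix F).submatrix (fun p => p.1.1) (fun p => p.1.1) ⊙ ρ := by
  ext p q
  simp only [randomizedQuery, phaseOracleExt_eq, queryMatrix, Matrix.smul_apply, Matrix.sum_apply,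
    Matrix.hadamard_apply, Matrix.submatrix_apply, Matrix.of_apply,
    Matrix.diagonal_conjTranspose, Matrix.mul_diagonal, Matrix.diagonal_mul, smul_eq_mul,
    Pi.star_apply, Finset.mul_sum, Finset.sum_mul]
  refine Finset.sum_congr rfl fun f _ => ?_
  ring

theorem randomizedQuery_sub {N w d : ℕ} (F : Finset (Equiv.Perm (Fin N)))
    (ρ σ : Matrix (Reg N w d) (Reg N w d) ℂ) :
    randomizedQuery F (ρ - σ) = randomizedQuery F ρ - randomizedQuery F σ := by
  simp only [randomizedQuery_eq]
  ext; simp [mul_sub]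

theorem queryMatrix_posSemidef {N : ℕ} (F : Finset (Equiv.Perm (Fin N))) :
    (queryMatrix F).PosSemidef := by
  refine Matrix.PosSemidef.smul (Matrix.posSemidef_sum _ fun f _ => ?_) (by positivity)
  exact Matrix.posSemidef_vecMulVec_self_star (phase f)

theorem queryMatrix_diag {N : ℕ} {F : Finset (Equiv.Perm (Fin N))} (hF : F.Nonempty)
    (p : OracleReg N) : queryMatrix F p p = 1 := by
  have h : ∀ f : Equiv.Perm (Fin N), phase f p * star (phase f p) = 1 := fun f => by
    have := Complex.mul_conj' (phase f p)
    simpa [norm_phase] using this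
  have hc : (F.card : ℂ) ≠ 0 := by exact_mod_cast hF.card_pos.ne'
  rw [queryMatrix, Matrix.smul_apply, Matrix.sum_apply]
  simp only [Matrix.of_apply, h]
  simp [hc]

theorem IsDensity.randomizedQuery {N w d : ℕ} {F : Finset (Equiv.Perm (Fin N))} (hF : F.Nonempty)
    {ρ : Matrix (Reg N w d) (Reg N w d) ℂ} (hρ : IsDensity ρ) :
    IsDensity (randomizedQuery F ρ) := by
  rw [randomizedQuery_eq]
  refine ⟨((queryMatrix_posSemidef F).submatrix _).hadamard hρ.1, ?_⟩
  rw [← hρ.2]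
  simp [Matrix.trace, queryMatrix_diag hF]

theorem IsDensity.evolve {N w d : ℕ} (A : QueryAlgorithm N w d) (i : ℕ)
    {ρ : Matrix (Reg N w d) (Reg N w d) ℂ} (hρ : IsDensity ρ) : IsDensity (A.evolve i ρ) := by
  refine ⟨hρ.1.mul_mul_conjTranspose_same _, ?_⟩
  rw [QueryAlgorithm.evolve, Matrix.trace_mul_comm, ← Matrix.mul_assoc]
  have : (A.U i : Matrix (Reg N w d) (Reg N w d) ℂ).conjTranspose * (A.U i).1 = 1 :=
    Matrix.mem_unitaryGroup_iff'.mp (A.U i).2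
  rw [this, Matrix.one_mul, hρ.2]

theorem IsDensity.state {N w d : ℕ} (A : QueryAlgorithm N w d)
    {F : Finset (Equiv.Perm (Fin N))} (hF : F.Nonempty)
    {ρ : Matrix (Reg N w d) (Reg N w d) ℂ} (hρ : IsDensity ρ) (i : ℕ) :
    IsDensity (A.state F ρ i) := by
  induction i with
  | zero => exact hρ
  | succ i ih => exact (ih.evolve A i).randomizedQuery hF

/-! ### Effect bounds and the hybrid argument -/

/-- No effect has an expectation greater than `δ` in `X`. -/
def EffectBound {κ : Type} [Fintype κ] [DecidableEq κ] (X : Matrix κ κ ℂ) (δ : ℝ) : Prop :=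
  ∀ E : Matrix κ κ ℂ, E.PosSemidef → (1 - E).PosSemidef → ‖(E * X).trace‖ ≤ δ

theorem EffectBound.add {κ : Type} [Fintype κ] [DecidableEq κ] {X Y : Matrix κ κ ℂ} {δ ε : ℝ}
    (hX : EffectBound X δ) (hY : EffectBound Y ε) : EffectBound (X + Y) (δ + ε) := by
  intro E hE hE'
  rw [Matrix.mul_add, Matrix.trace_add]
  exact (norm_add_le _ _).trans (add_le_add (hX E hE hE') (hY E hE hE'))

/-- The unitary moves to the other side of the trace, where `Uᴴ E U` is again an effect. -/
theorem EffectBound.conj_unitary {κ : Type} [Fintype κ] [DecidableEq κ] {X : Matrix κ κ ℂ}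
    {δ : ℝ} (hX : EffectBound X δ) {U : Matrix κ κ ℂ} (hU : U ∈ Matrix.unitaryGroup κ ℂ) :
    EffectBound (U * X * Uᴴ) δ := by
  intro E hE hE'
  have h : (E * (U * X * Uᴴ)).trace = (Uᴴ * E * U * X).trace := by
    rw [← Matrix.mul_assoc, Matrix.trace_mul_comm]
    simp only [Matrix.mul_assoc]
  rw [h]
  refine hX _ (hE.conjTranspose_mul_mul_same U) ?_
  have h1 : Uᴴ * U = 1 := Matrix.mem_unitaryGroup_iff'.mp hU
  have := hE'.conjTranspose_mul_mul_same U
  rwa [Matrix.mul_sub, Matrix.sub_mul, Matrix.mul_one, h1] at this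

theorem phaseOracleExt_mem_unitaryGroup {N w d : ℕ} (f : Equiv.Perm (Fin N)) :
    phaseOracleExt w d f ∈ Matrix.unitaryGroup (Reg N w d) ℂ := by
  rw [Matrix.mem_unitaryGroup_iff, phaseOracleExt_eq, Matrix.star_eq_conjTranspose,
    Matrix.diagonal_conjTranspose, Matrix.diagonal_mul_diagonal, ← Matrix.diagonal_one]
  congr 1
  ext p
  have := Complex.mul_conj' (phase f p.1.1)
  simpa [norm_phase] using this

theorem EffectBound.randomizedQuery {N w d : ℕ} {F : Finset (Equiv.Perm (Fin N))}
    (hF : F.Nonempty) {X : Matrix (Reg N w d) (Reg N w d) ℂ} {δ : ℝ} (hX : EffectBound X δ) :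
    EffectBound (randomizedQuery F X) δ := by
  intro E hE hE'
  rw [PhaseOracle.randomizedQuery, Matrix.mul_smul, Matrix.trace_smul, Matrix.mul_sum,
    Matrix.trace_sum, norm_smul, norm_inv, Complex.norm_natCast]
  have hc : (0 : ℝ) < F.card := by exact_mod_cast hF.card_pos
  rw [inv_mul_le_iff₀ hc]
  refine (norm_sum_le_of_le _ fun f _ =>
    hX.conj_unitary (phaseOracleExt_mem_unitaryGroup f) E hE hE').trans ?_
  simp

/-- The hybrid argument. -/
theorem effectBound_state_sub {N w d : ℕ} (A : QueryAlgorithm N w d)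
    {F G : Finset (Equiv.Perm (Fin N))} (hF : F.Nonempty) (hG : G.Nonempty) {δ : ℝ}
    (h : SchurBound (queryMatrix F - queryMatrix G) δ)
    {ρ : Matrix (Reg N w d) (Reg N w d) ℂ} (hρ : IsDensity ρ) (i : ℕ) :
    EffectBound (A.state F ρ i - A.state G ρ i) (i * δ) := by
  induction i with
  | zero => intro E _ _; simp [QueryAlgorithm.state]
  | succ i ih =>
    have hd := (hρ.state A hG i).evolve A i
    -- The old discrepancy passes through the query to `F`, which does not amplify it; the new one
    -- comes from applying the two different queries to the same state, that of the run on `G`.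
    have e : A.state F ρ (i + 1) - A.state G ρ (i + 1) =
        randomizedQuery F (A.evolve i (A.state F ρ i - A.state G ρ i)) +
          (queryMatrix F - queryMatrix G).submatrix (fun p => p.1.1) (fun p => p.1.1) ⊙
            A.evolve i (A.state G ρ i) := by
      have h1 : A.evolve i (A.state F ρ i - A.state G ρ i) =
          A.evolve i (A.state F ρ i) - A.evolve i (A.state G ρ i) := by
        simp only [QueryAlgorithm.evolve, Matrix.mul_sub, Matrix.sub_mul]
      rw [h1, randomizedQuery_sub, QueryAlgorithm.state, QueryAlgorithm.state]
      simp only [randomizedQuery_eq]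
      ext p q
      simp only [Matrix.add_apply, Matrix.sub_apply, Matrix.hadamard_apply,
        Matrix.submatrix_apply]
      ring
    rw [e, Nat.cast_succ, add_mul, one_mul]
    refine ((ih.conj_unitary (A.U i).2).randomizedQuery hF).add fun E hE hE' => ?_
    have := h _ (fun p : Reg N w d => p.1.1) _ E hd.1 hE hE'
    rwa [hd.2, Complex.one_re, mul_one] at this

theorem abs_acceptProb_sub_le {N w d : ℕ} (A : QueryAlgorithm N w d)
    {F G : Finset (Equiv.Perm (Fin N))} (hF : F.Nonempty) (hG : G.Nonempty) {δ : ℝ}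
    (h : SchurBound (queryMatrix F - queryMatrix G) δ)
    {ρ : Matrix (Reg N w d) (Reg N w d) ℂ} (hρ : IsDensity ρ) :
    |A.acceptProb F ρ - A.acceptProb G ρ| ≤ A.queries * δ := by
  have := effectBound_state_sub A hF hG h hρ A.queries A.E A.E_nonneg A.E_le_one
  rw [Matrix.mul_sub, Matrix.trace_sub] at this
  rw [QueryAlgorithm.acceptProb, QueryAlgorithm.acceptProb, ← Complex.sub_re]
  exact (Complex.abs_re_le_norm _).trans this

/-! ### Averages over the permutations preserving a partition -/

/-- The two sides of the partition into `V` and its complement. -/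
def block {N : ℕ} (V : Finset (Fin N)) (s : Bool) : Finset (Fin N) :=
  Finset.univ.filter fun x => decide (x ∈ V) = s

theorem mem_block {N : ℕ} {V : Finset (Fin N)} {s : Bool} {x : Fin N} :
    x ∈ block V s ↔ decide (x ∈ V) = s := by simp [block]

theorem mem_stabilizing {N : ℕ} {V : Finset (Fin N)} {f : Equiv.Perm (Fin N)} :
    f ∈ stabilizing V ↔ ∀ x s, f x ∈ block V s ↔ x ∈ block V s := by
  simp only [stabilizing, Finset.mem_filter, Finset.mem_univ, true_and, mem_block]
  refine forall_congr' fun x => ⟨fun h s => by rw [decide_eq_decide.mpr h], fun h => ?_⟩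
  simpa using (h true).symm

theorem mul_mem_stabilizing {N : ℕ} {V : Finset (Fin N)} {f g : Equiv.Perm (Fin N)}
    (hf : f ∈ stabilizing V) (hg : g ∈ stabilizing V) : f * g ∈ stabilizing V := by
  rw [mem_stabilizing] at *
  intro x s
  rw [Equiv.Perm.mul_apply, hf, hg]

theorem inv_mem_stabilizing {N : ℕ} {V : Finset (Fin N)} {f : Equiv.Perm (Fin N)}
    (hf : f ∈ stabilizing V) : f⁻¹ ∈ stabilizing V := by
  rw [mem_stabilizing] at *
  intro x s
  rw [← hf]
  simp

theorem one_mem_stabilizing {N : ℕ} (V : Finset (Fin N)) : 1 ∈ stabilizing V := by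
  simp [stabilizing]

theorem stabilizing_nonempty {N : ℕ} (V : Finset (Fin N)) : (stabilizing V).Nonempty :=
  ⟨1, one_mem_stabilizing V⟩

theorem swap_mem_stabilizing {N : ℕ} {V : Finset (Fin N)} {s : Bool} {x y : Fin N}
    (hx : x ∈ block V s) (hy : y ∈ block V s) : Equiv.swap x y ∈ stabilizing V := by
  rw [mem_stabilizing]
  intro z t
  rw [mem_block] at hx hy
  rw [Equiv.swap_apply_def]
  split_ifs with h h
  · subst h; rw [mem_block, mem_block, hx, hy]
  · subst h; rw [mem_block, mem_block, hx, hy]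
  · rfl

/-- If the weight `h` is invariant under the transpositions of elements of `R`, then the image of
`b` is uniformly distributed on `R`. -/
theorem card_mul_sum_weight {N : ℕ} {V R : Finset (Fin N)} {s : Bool} (hR : R ⊆ block V s)
    (h : Equiv.Perm (Fin N) → ℂ) (b : Fin N)
    (hinv : ∀ y ∈ R, ∀ y' ∈ R, ∀ f, h (Equiv.swap y y' * f) = h f)
    (hsupp : ∀ f ∈ stabilizing V, h f ≠ 0 → f b ∈ R) (v : Fin N → ℂ) :
    (R.card : ℂ) * ∑ f ∈ stabilizing V, h f * v (f b) =
      (∑ f ∈ stabilizing V, h f) * ∑ y ∈ R, v y := by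
  let c : Fin N → ℂ := fun y => ∑ f ∈ stabilizing V, if f b = y then h f else 0
  -- Left multiplication by the transposition of `y` and `y'` exchanges the `f` with `f b = y` and
  -- those with `f b = y'`, without changing their weights.
  have hc : ∀ y ∈ R, ∀ y' ∈ R, c y = c y' := by
    intro y hy y' hy'
    have hs := swap_mem_stabilizing (hR hy) (hR hy')
    refine Finset.sum_nbij' (fun f => Equiv.swap y y' * f) (fun f => Equiv.swap y y' * f)
      (fun f hf => mul_mem_stabilizing hs hf) (fun f hf => mul_mem_stabilizing hs hf)
      (fun f _ => by simp) (fun f _ => by simp) fun f _ => ?_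
    rw [hinv y hy y' hy', Equiv.Perm.mul_apply]
    congr 1
    rw [Equiv.swap_apply_eq_iff, Equiv.swap_apply_right]
  have hsum : ∀ v : Fin N → ℂ, ∑ f ∈ stabilizing V, h f * v (f b) = ∑ y ∈ R, v y * c y := by
    intro v
    simp only [c, Finset.mul_sum]
    rw [Finset.sum_comm]
    refine Finset.sum_congr rfl fun f hf => ?_
    by_cases h0 : h f = 0
    · simp [h0]
    · rw [Finset.sum_eq_single (f b)]
      · simp [mul_comm]
      · intro y _ hy
        simp [hy.symm]
      · intro hn
        exact absurd (hsupp f hf h0) hn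
  have h1 : ∑ f ∈ stabilizing V, h f = ∑ y ∈ R, c y := by
    simpa using hsum fun _ => 1
  rw [hsum, h1]
  rcases R.eq_empty_or_nonempty with rfl | ⟨y₀, hy₀⟩
  · simp
  · rw [Finset.sum_congr rfl fun y hy => by rw [hc y hy y₀ hy₀],
      Finset.sum_congr rfl fun y hy => hc y hy y₀ hy₀, ← Finset.sum_mul]
    simp
    ring

/-- The expectation of `g f` for `f` uniform in `F`. -/
def average {N : ℕ} (F : Finset (Equiv.Perm (Fin N))) (g : Equiv.Perm (Fin N) → ℂ) : ℂ :=
  (F.card : ℂ)⁻¹ * ∑ f ∈ F, g f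

section average

variable {N : ℕ} {V : Finset (Fin N)}

theorem card_stabilizing_ne_zero (V : Finset (Fin N)) : ((stabilizing V).card : ℂ) ≠ 0 := by
  exact_mod_cast (stabilizing_nonempty V).card_pos.ne'

theorem card_block_ne_zero {s : Bool} {x : Fin N} (hx : x ∈ block V s) :
    ((block V s).card : ℂ) ≠ 0 := by
  exact_mod_cast (Finset.card_pos.mpr ⟨x, hx⟩).ne'

theorem sum_stabilizing {s : Bool} {x : Fin N} (hx : x ∈ block V s) (u : Fin N → ℂ) :
    ∑ f ∈ stabilizing V, u (f x) =
      ((stabilizing V).card : ℂ) * ((block V s).card : ℂ)⁻¹ * ∑ a ∈ block V s, u a := by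
  have := card_mul_sum_weight (Finset.Subset.refl (block V s)) (fun _ => 1) x
    (fun _ _ _ _ _ => rfl) (fun f hf _ => ((mem_stabilizing.mp hf) x s).mpr hx) u
  simp only [one_mul, Finset.sum_const, nsmul_eq_mul, mul_one] at this
  have hm := card_block_ne_zero hx
  rw [mul_right_comm, ← this]
  field_simp

theorem average_apply {s : Bool} {x : Fin N} (hx : x ∈ block V s) (u : Fin N → ℂ) :
    average (stabilizing V) (fun f => u (f x)) =
      ((block V s).card : ℂ)⁻¹ * ∑ a ∈ block V s, u a := by
  have := card_stabilizing_ne_zero V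
  rw [average, sum_stabilizing hx]
  field_simp

/-- The sum over the `f` that map `x` to `a`, when the remaining image of `b` is uniform on `R`. -/
theorem card_mul_sum_ite {s t : Bool} {x a : Fin N} (hx : x ∈ block V s) (ha : a ∈ block V s)
    {R : Finset (Fin N)} (hR : R ⊆ block V t) (haR : a ∉ R) (b : Fin N)
    (hb : ∀ f ∈ stabilizing V, f x = a → f b ∈ R) (v : Fin N → ℂ) :
    (R.card : ℂ) * ∑ f ∈ stabilizing V, (if f x = a then 1 else 0) * v (f b) =
      ((stabilizing V).card : ℂ) * ((block V s).card : ℂ)⁻¹ * ∑ y ∈ R, v y := by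
  have := card_mul_sum_weight hR (fun f => if f x = a then 1 else 0) b ?_ ?_ v
  · rw [this, sum_stabilizing hx fun y => if y = a then 1 else 0]
    simp [ha]
  · intro y hy y' hy' f
    have h1 : y ≠ a := fun h => haR (h ▸ hy)
    have h2 : y' ≠ a := fun h => haR (h ▸ hy')
    have e : (Equiv.swap y y' * f) x = a ↔ f x = a := by
      rw [Equiv.Perm.mul_apply, Equiv.swap_apply_eq_iff,
        Equiv.swap_apply_of_ne_of_ne h1.symm h2.symm]
    simp only [e]
  · intro f hf h
    exact hb f hf (by by_contra h'; simp [h'] at h)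

theorem sum_mul_eq_sum_ite {s : Bool} {x : Fin N} (hx : x ∈ block V s) (b : Fin N)
    (u v : Fin N → ℂ) :
    ∑ f ∈ stabilizing V, u (f x) * v (f b) =
      ∑ a ∈ block V s, u a * ∑ f ∈ stabilizing V, (if f x = a then 1 else 0) * v (f b) := by
  simp only [Finset.mul_sum]
  rw [Finset.sum_comm]
  refine Finset.sum_congr rfl fun f hf => ?_
  rw [Finset.sum_eq_single (f x)]
  · simp
  · intro a _ ha
    simp [ha.symm]
  · intro h
    exact absurd (((mem_stabilizing.mp hf) x s).mpr hx) h

/-- Images of points on different sides are independent. -/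
theorem average_mul_of_ne_block {s t : Bool} (hst : s ≠ t) {x b : Fin N} (hx : x ∈ block V s)
    (hb : b ∈ block V t) (u v : Fin N → ℂ) :
    average (stabilizing V) (fun f => u (f x) * v (f b)) =
      (((block V s).card : ℂ)⁻¹ * ∑ a ∈ block V s, u a) *
        (((block V t).card : ℂ)⁻¹ * ∑ a ∈ block V t, v a) := by
  have hT := card_stabilizing_ne_zero V
  have hm := card_block_ne_zero hb
  rw [average, sum_mul_eq_sum_ite hx]
  have : ∀ a ∈ block V s, u a * ∑ f ∈ stabilizing V, (if f x = a then 1 else 0) * v (f b) =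
      u a * (((stabilizing V).card : ℂ) * ((block V s).card : ℂ)⁻¹ *
        (((block V t).card : ℂ)⁻¹ * ∑ a ∈ block V t, v a)) := by
    intro a ha
    have := card_mul_sum_ite hx ha (Finset.Subset.refl (block V t))
      (fun h => hst ((mem_block.mp ha).symm.trans (mem_block.mp h))) b
      (fun f hf _ => ((mem_stabilizing.mp hf) b t).mpr hb) v
    rw [mul_left_comm _ ((block V t).card : ℂ)⁻¹, ← this]
    field_simp
  rw [Finset.sum_congr rfl this, ← Finset.sum_mul]
  field_simp

/-- Two points on one side have images drawn without replacement: given `f x = a`, the image of `b`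
is uniform on the side minus `a`. -/
theorem average_mul_of_ne {s : Bool} {x b : Fin N} (hxb : x ≠ b) (hx : x ∈ block V s)
    (hb : b ∈ block V s) (u v : Fin N → ℂ) :
    average (stabilizing V) (fun f => u (f x) * v (f b)) =
      ((block V s).card * ((block V s).card - 1) : ℂ)⁻¹ *
        ((∑ a ∈ block V s, u a) * (∑ a ∈ block V s, v a) - ∑ a ∈ block V s, u a * v a) := by
  have hT := card_stabilizing_ne_zero V
  have hm := card_block_ne_zero hb
  have h1 : 1 < (block V s).card := Finset.one_lt_card.mpr ⟨x, hx, b, hb, hxb⟩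
  have hm1 : ((block V s).card : ℂ) - 1 ≠ 0 := by
    rw [sub_ne_zero]; exact_mod_cast h1.ne'
  rw [average, sum_mul_eq_sum_ite hx]
  have : ∀ a ∈ block V s, u a * ∑ f ∈ stabilizing V, (if f x = a then 1 else 0) * v (f b) =
      ((stabilizing V).card : ℂ) * (((block V s).card * ((block V s).card - 1) : ℂ)⁻¹ *
        (u a * (∑ a ∈ block V s, v a) - u a * v a)) := by
    intro a ha
    have := card_mul_sum_ite hx ha (Finset.erase_subset a (block V s)) (by simp) b
      (fun f hf h => Finset.mem_erase.mpr ⟨fun h' => hxb (f.injective (h.trans h'.symm)),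
        ((mem_stabilizing.mp hf) b s).mpr hb⟩) v
    rw [Finset.card_erase_of_mem ha, Nat.cast_pred (by omega),
      Finset.sum_erase_eq_sub ha] at this
    rw [← mul_sub, mul_left_comm _ (u a), mul_left_comm _ (u a)]
    congr 1
    rw [mul_inv, ← mul_right_inj' hm1, this]
    field_simp
  rw [Finset.sum_congr rfl this, ← Finset.mul_sum, ← Finset.mul_sum, Finset.sum_sub_distrib,
    ← Finset.sum_mul]
  field_simp

theorem average_comp_inv (g : Equiv.Perm (Fin N) → ℂ) :
    average (stabilizing V) (fun f => g f⁻¹) = average (stabilizing V) g := by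
  rw [average, average]
  congr 1
  exact Finset.sum_nbij' (fun f => f⁻¹) (fun f => f⁻¹) (fun f hf => inv_mem_stabilizing hf)
    (fun f hf => inv_mem_stabilizing hf) (by simp) (by simp) (by simp)

/-- Conditioning on the preimage `b` of `y` reduces averages involving both `f` and its inverse to
averages over two images. -/
theorem average_mul_inv {t : Bool} {y : Fin N} (hy : y ∈ block V t) (x : Fin N)
    (u v : Fin N → ℂ) :
    average (stabilizing V) (fun f => u (f x) * v (f⁻¹ y)) =
      ∑ b ∈ block V t, v b *
        average (stabilizing V) (fun f => u (f x) * if f b = y then 1 else 0) := by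
  simp only [average, Finset.mul_sum]
  rw [Finset.sum_comm]
  refine Finset.sum_congr rfl fun f hf => ?_
  rw [Finset.sum_eq_single (f⁻¹ y)]
  · simp
    ring
  · intro b _ hb
    have : f b ≠ y := fun h => hb (by rw [← h]; simp)
    simp [this]
  · intro h
    exact absurd (((mem_stabilizing.mp (inv_mem_stabilizing hf)) y t).mpr hy) h

theorem average_mul_inv_of_ne_block {s t : Bool} (hst : s ≠ t) {x y : Fin N}
    (hx : x ∈ block V s) (hy : y ∈ block V t) (u v : Fin N → ℂ) :
    average (stabilizing V) (fun f => u (f x) * v (f⁻¹ y)) =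
      (((block V s).card : ℂ)⁻¹ * ∑ a ∈ block V s, u a) *
        (((block V t).card : ℂ)⁻¹ * ∑ a ∈ block V t, v a) := by
  rw [average_mul_inv hy]
  have : ∀ b ∈ block V t, v b *
      average (stabilizing V) (fun f => u (f x) * if f b = y then 1 else 0) =
      v b * ((((block V s).card : ℂ)⁻¹ * ∑ a ∈ block V s, u a) * ((block V t).card : ℂ)⁻¹) := by
    intro b hb
    rw [average_mul_of_ne_block hst hx hb u fun a => if a = y then 1 else 0]
    simp [hy]
  rw [Finset.sum_congr rfl this, ← Finset.sum_mul]
  ring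

/-- Either `f x = y`, with probability `1/m`, and both values are determined; or `f x` avoids `y`,
`f⁻¹ y` avoids `x`, and the pair is uniform on what remains. -/
theorem average_mul_inv_of_mem {s : Bool} {x y : Fin N} (hx : x ∈ block V s)
    (hy : y ∈ block V s) (u v : Fin N → ℂ) :
    average (stabilizing V) (fun f => u (f x) * v (f⁻¹ y)) =
      ((block V s).card * ((block V s).card - 1) : ℂ)⁻¹ *
        ((∑ a ∈ block V s, u a - u y) * (∑ a ∈ block V s, v a - v x)) +
        ((block V s).card : ℂ)⁻¹ * (u y * v x) := by
  rw [average_mul_inv hy, ← Finset.add_sum_erase _ _ hx]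
  have h1 : average (stabilizing V) (fun f => u (f x) * if f x = y then 1 else 0) =
      ((block V s).card : ℂ)⁻¹ * u y := by
    rw [average_apply hx fun a => u a * if a = y then 1 else 0]
    simp [hy]
  have h2 : ∀ b ∈ (block V s).erase x, v b *
      average (stabilizing V) (fun f => u (f x) * if f b = y then 1 else 0) =
      v b * (((block V s).card * ((block V s).card - 1) : ℂ)⁻¹ *
        (∑ a ∈ block V s, u a - u y)) := by
    intro b hb
    rw [Finset.mem_erase] at hb
    rw [average_mul_of_ne hb.1.symm hx hb.2 u fun a => if a = y then 1 else 0]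
    simp [hy]
  rw [h1, Finset.sum_congr rfl h2, ← Finset.sum_mul, Finset.sum_erase_eq_sub hx]
  ring

end average

/-! ### The entries of the query matrix -/

/-- The values of the phases. -/
def chi {N : ℕ} (a : Fin N) : ℂ := omega N ^ (a : ℕ)

theorem norm_chi {N : ℕ} (a : Fin N) : ‖chi a‖ = 1 := by
  rw [chi, norm_pow, norm_omega, one_pow]

theorem chi_mul_star {N : ℕ} (a : Fin N) : chi a * star (chi a) = 1 := by
  have := Complex.mul_conj' (chi a)
  simpa [norm_chi] using this

theorem phase_one {N : ℕ} (f : Equiv.Perm (Fin N)) (x : Fin N) : phase f (x, 1) = chi (f x) := by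
  simp [phase, chi]

theorem phase_neg_one {N : ℕ} (f : Equiv.Perm (Fin N)) (x : Fin N) :
    phase f (x, -1) = chi (f⁻¹ x) := by
  simp [phase, chi]

/-- The sum of the phases over one side of the partition. -/
def blockSum {N : ℕ} (V : Finset (Fin N)) (s : Bool) : ℂ := ∑ a ∈ block V s, chi a

theorem queryMatrix_apply {N : ℕ} (F : Finset (Equiv.Perm (Fin N))) (p q : OracleReg N) :
    queryMatrix F p q = average F fun f => phase f p * star (phase f q) := by
  simp [queryMatrix, average, Matrix.sum_apply]

theorem star_queryMatrix_apply {N : ℕ} (F : Finset (Equiv.Perm (Fin N))) (p q : OracleReg N) :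
    star (queryMatrix F p q) = queryMatrix F q p := by
  have := congrFun (congrFun (queryMatrix_posSemidef F).isHermitian q) p
  rwa [Matrix.conjTranspose_apply] at this

section entries

variable {N : ℕ} {V : Finset (Fin N)}

theorem star_blockSum (V : Finset (Fin N)) (s : Bool) :
    star (blockSum V s) = ∑ a ∈ block V s, star (chi a) := star_sum _ _

theorem queryMatrix_of_ne_block {s t : Bool} (hst : s ≠ t) {x y : Fin N}
    (hx : x ∈ block V s) (hy : y ∈ block V t) (z z' : ℤˣ) :
    queryMatrix (stabilizing V) (x, z) (y, z') =
      (((block V s).card : ℂ)⁻¹ * blockSum V s) *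
        (((block V t).card : ℂ)⁻¹ * star (blockSum V t)) := by
  have pos : ∀ {s t : Bool}, s ≠ t → ∀ {x y : Fin N}, x ∈ block V s → y ∈ block V t →
      average (stabilizing V) (fun f => chi (f x) * star (chi (f y))) =
        (((block V s).card : ℂ)⁻¹ * blockSum V s) *
        (((block V t).card : ℂ)⁻¹ * star (blockSum V t)) := by
    intro s t hst x y hx hy
    rw [average_mul_of_ne_block hst hx hy chi fun a => star (chi a), star_blockSum, blockSum]
  have mixed : ∀ {s t : Bool}, s ≠ t → ∀ {x y : Fin N}, x ∈ block V s → y ∈ block V t →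
      queryMatrix (stabilizing V) (x, 1) (y, -1) =
        (((block V s).card : ℂ)⁻¹ * blockSum V s) *
        (((block V t).card : ℂ)⁻¹ * star (blockSum V t)) := by
    intro s t hst x y hx hy
    simp only [queryMatrix_apply, phase_one, phase_neg_one]
    rw [average_mul_inv_of_ne_block hst hx hy chi fun a => star (chi a), star_blockSum, blockSum]
  rcases Int.units_eq_one_or z with rfl | rfl <;> rcases Int.units_eq_one_or z' with rfl | rfl
  · simp only [queryMatrix_apply, phase_one]
    exact pos hst hx hy
  · exact mixed hst hx hy
  · rw [← star_queryMatrix_apply, mixed hst.symm hy hx]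
    simp only [star_mul', star_inv₀, star_natCast, star_star]
    ring
  · simp only [queryMatrix_apply, phase_neg_one]
    rw [average_comp_inv fun f => chi (f x) * star (chi (f y))]
    exact pos hst hx hy

theorem queryMatrix_of_ne {s : Bool} {x y : Fin N} (hxy : x ≠ y)
    (hx : x ∈ block V s) (hy : y ∈ block V s) (z : ℤˣ) :
    queryMatrix (stabilizing V) (x, z) (y, z) =
      ((block V s).card * ((block V s).card - 1) : ℂ)⁻¹ *
        (blockSum V s * star (blockSum V s) - (block V s).card) := by
  have pos : average (stabilizing V) (fun f => chi (f x) * star (chi (f y))) =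
      ((block V s).card * ((block V s).card - 1) : ℂ)⁻¹ *
        (blockSum V s * star (blockSum V s) - (block V s).card) := by
    rw [average_mul_of_ne hxy hx hy chi fun a => star (chi a), star_blockSum, blockSum]
    simp only [chi_mul_star]
    simp
  rcases Int.units_eq_one_or z with rfl | rfl
  · simp only [queryMatrix_apply, phase_one]
    exact pos
  · simp only [queryMatrix_apply, phase_neg_one]
    rw [average_comp_inv fun f => chi (f x) * star (chi (f y))]
    exact pos

/-- Unlike for equal signs, the case `x = y` is not exceptional: the block is a sum of two rank one
matrices, the second one coming from the event that `f` or its inverse maps `x` to `y`. -/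
theorem queryMatrix_of_sign_ne {s : Bool} {x y : Fin N}
    (hx : x ∈ block V s) (hy : y ∈ block V s) {z z' : ℤˣ} (hz : z ≠ z') :
    queryMatrix (stabilizing V) (x, z) (y, z') =
      ((block V s).card * ((block V s).card - 1) : ℂ)⁻¹ *
        ((star (blockSum V s) - star (chi x)) * star (star (blockSum V s) - star (chi y))) +
        ((block V s).card : ℂ)⁻¹ * (star (chi x) * star (star (chi y))) := by
  have mixed : ∀ {x y : Fin N}, x ∈ block V s → y ∈ block V s →
      queryMatrix (stabilizing V) (x, 1) (y, -1) =
      ((block V s).card * ((block V s).card - 1) : ℂ)⁻¹ *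
        ((star (blockSum V s) - star (chi x)) * star (star (blockSum V s) - star (chi y))) +
        ((block V s).card : ℂ)⁻¹ * (star (chi x) * star (star (chi y))) := by
    intro x y hx hy
    simp only [queryMatrix_apply, phase_one, phase_neg_one]
    rw [average_mul_inv_of_mem hx hy chi fun a => star (chi a), star_sub, star_star, star_star,
      star_blockSum, blockSum]
    ring
  rcases Int.units_eq_one_or z with rfl | rfl <;> rcases Int.units_eq_one_or z' with rfl | rfl
  · exact absurd rfl hz
  · exact mixed hx hy
  · rw [← star_queryMatrix_apply, mixed hy hx]
    simp only [star_add, star_mul', star_sub, star_inv₀, star_natCast, star_star, star_one]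
    ring
  · exact absurd rfl hz

end entries

/-! ### Closeness to complete dephasing -/

theorem SchurBound.rankOne_of_le {ι : Type} {l r : ι → ℂ} {a : ℝ} (ha : 0 < a)
    (hl : ∀ p, ‖l p‖ ≤ a) (hr : ∀ p, ‖r p‖ ≤ a) :
    SchurBound (Matrix.of fun p q => l p * star (r q)) (4 * a ^ 2) := by
  have hb : ∀ g : ι → ℂ, (∀ p, ‖g p‖ ≤ a) → ∀ p, ‖(a : ℂ)⁻¹ * g p‖ ≤ 1 := by
    intro g hg p
    rw [norm_mul, norm_inv, Complex.norm_of_nonneg ha.le, inv_mul_le_iff₀ ha, mul_one]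
    exact hg p
  have := (SchurBound.rankOne (hb l hl) (hb r hr)).smul ((a : ℂ) ^ 2)
  rw [norm_pow, Complex.norm_of_nonneg ha.le, mul_comm] at this
  convert this using 1
  ext p q
  have : (a : ℂ) ≠ 0 := by exact_mod_cast ha.ne'
  simp only [Matrix.of_apply, Matrix.smul_apply, smul_eq_mul, star_mul', star_inv₀,
    Complex.star_def, Complex.conj_ofReal]
  field_simp

/-- Both sides of the partition, unless empty, are large and have phase sums of square root
size. -/
def Balanced {N : ℕ} (V : Finset (Fin N)) (η : ℝ) : Prop :=
  ∀ s, (block V s).Nonempty → 2 ≤ (block V s).card ∧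
    (‖blockSum V s‖ + 1) ^ 2 ≤ η * (block V s).card ^ 2 ∧ 1 ≤ η * (block V s).card

/-- There are four blocks (sign and side), hence 16 pairs; each costs the factor 4 of
`SchurBound.of_blocks` and a multiplier bounded by `12 η`, so `768 = 16 * 4 * 12`. -/
theorem Balanced.schurBound {N : ℕ} {V : Finset (Fin N)} {η : ℝ} (hη : 0 ≤ η)
    (hV : Balanced V η) : SchurBound (queryMatrix (stabilizing V) - 1) (768 * η) := by
  have hcard : Fintype.card (ℤˣ × Bool) = 4 := by decide
  have key := SchurBound.of_blocks (fun p : OracleReg N => (p.2, decide (p.1 ∈ V)))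
    (M := queryMatrix (stabilizing V) - 1) (c := 12 * η) (by positivity) ?_
  · rw [hcard] at key
    exact key.mono (le_of_eq (by push_cast; ring))
  rintro ⟨z, s⟩ ⟨z', t⟩
  by_cases hs : (block V s).Nonempty
  swap
  · refine ⟨0, SchurBound.zero.mono (by positivity), fun p q hp _ => absurd ?_ hs⟩
    exact ⟨p.1, mem_block.mpr (congrArg Prod.snd hp)⟩
  by_cases ht : (block V t).Nonempty
  swap
  · refine ⟨0, SchurBound.zero.mono (by positivity), fun p q _ hq => absurd ?_ ht⟩
    exact ⟨q.1, mem_block.mpr (congrArg Prod.snd hq)⟩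
  obtain ⟨h2, hS, hm⟩ := hV s hs
  set m : ℝ := ((block V s).card : ℝ) with hmdef
  have hm2 : (2 : ℝ) ≤ m := by rw [hmdef]; exact_mod_cast h2
  have hm0 : 0 < m := by linarith
  set k : ℂ := ((block V s).card * ((block V s).card - 1) : ℂ)⁻¹ with hk
  have hknorm : ‖k‖ = (m * (m - 1))⁻¹ := by
    have : k = (((m * (m - 1))⁻¹ : ℝ) : ℂ) := by rw [hk, hmdef]; push_cast; rfl
    rw [this, Complex.norm_of_nonneg (by
      have : 0 ≤ m - 1 := by linarith
      positivity)]
  -- Since `m ≥ 2`, `m - 1 ≥ m / 2`.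
  have hkle : ‖k‖ ≤ 2 / m ^ 2 := by
    rw [hknorm, inv_eq_one_div, div_le_div_iff₀ (by nlinarith) (by positivity)]
    nlinarith
  have hSm : (‖blockSum V s‖ + 1) ^ 2 / m ^ 2 ≤ η := by
    rw [div_le_iff₀ (by positivity)]; exact hS
  have hmη : 1 / m ≤ η := by rw [div_le_iff₀ hm0]; exact hm
  by_cases hst : s = t
  · subst hst
    by_cases hz : z = z'
    · subst hz
      -- Same sign and side: a constant off the diagonal and zero on it. The coefficient is at most
      -- `4 η`, and all-ones minus identity has bound 2, giving `8 η`.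
      refine ⟨(k * (blockSum V s * star (blockSum V s) - (block V s).card)) •
        (Matrix.of (fun _ _ => 1) - 1), ((SchurBound.const_one.sub SchurBound.one).smul _).mono ?_,
        ?_⟩
      · have h1 : ‖blockSum V s * star (blockSum V s) - (block V s).card‖ ≤
            ‖blockSum V s‖ ^ 2 + m := by
          refine (norm_sub_le _ _).trans (le_of_eq ?_)
          rw [norm_mul, norm_star, Complex.norm_natCast, sq]
        rw [norm_mul]
        have h3 : ‖blockSum V s‖ ^ 2 / m ^ 2 ≤ η := by
          refine le_trans ?_ hSm
          gcongr
          linarith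
        have h4 : ‖k‖ * ‖blockSum V s * star (blockSum V s) - (block V s).card‖ ≤
            2 / m ^ 2 * (‖blockSum V s‖ ^ 2 + m) :=
          mul_le_mul hkle h1 (norm_nonneg _) (by positivity)
        have h5 : 2 / m ^ 2 * (‖blockSum V s‖ ^ 2 + m) =
            2 * (‖blockSum V s‖ ^ 2 / m ^ 2) + 2 * (1 / m) := by
          field_simp
        nlinarith
      · rintro ⟨x, z₁⟩ ⟨y, z₂⟩ hp hq
        obtain ⟨rfl, hx⟩ := Prod.ext_iff.mp hp
        obtain ⟨h, hy⟩ := Prod.ext_iff.mp hq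
        dsimp only at h hx hy
        subst h
        by_cases hxy : x = y
        · subst hxy
          simp [queryMatrix_diag (stabilizing_nonempty V)]
        · rw [Matrix.sub_apply, queryMatrix_of_ne hxy (mem_block.mpr hx) (mem_block.mpr hy)]
          simp [hxy, hk]
    -- Opposite signs, same side: the two rank one terms contribute `8 η` and `4 η`, the worst case.
    -- The identity vanishes on this block.
    · refine ⟨k • (Matrix.of fun p q : OracleReg N => (star (blockSum V s) - star (chi p.1)) *
          star (star (blockSum V s) - star (chi q.1))) +
          ((block V s).card : ℂ)⁻¹ • (Matrix.of fun p q : OracleReg N =>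
            star (chi p.1) * star (star (chi q.1))), ?_, ?_⟩
      · have hn : ∀ p : OracleReg N,
            ‖star (blockSum V s) - star (chi p.1)‖ ≤ ‖blockSum V s‖ + 1 := fun p => by
          refine (norm_sub_le _ _).trans (le_of_eq ?_)
          rw [norm_star, norm_star, norm_chi]
        have h1 : ∀ p : OracleReg N, ‖star (chi p.1)‖ ≤ 1 := fun p => by
          rw [norm_star, norm_chi]
        refine (((SchurBound.rankOne_of_le (by positivity) hn hn).smul k).add
          ((SchurBound.rankOne h1 h1).smul _)).mono ?_
        have h3 : ‖((block V s).card : ℂ)⁻¹‖ = 1 / m := by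
          rw [norm_inv, Complex.norm_natCast, one_div]
        rw [h3]
        have h4 : ‖k‖ * (4 * (‖blockSum V s‖ + 1) ^ 2) ≤
            2 / m ^ 2 * (4 * (‖blockSum V s‖ + 1) ^ 2) :=
          mul_le_mul_of_nonneg_right hkle (by positivity)
        have h5 : 2 / m ^ 2 * (4 * (‖blockSum V s‖ + 1) ^ 2) =
            8 * ((‖blockSum V s‖ + 1) ^ 2 / m ^ 2) := by ring
        linarith
      · rintro ⟨x, z₁⟩ ⟨y, z₂⟩ hp hq
        obtain ⟨rfl, hx⟩ := Prod.ext_iff.mp hp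
        obtain ⟨rfl, hy⟩ := Prod.ext_iff.mp hq
        dsimp only at hz hx hy
        rw [Matrix.sub_apply, queryMatrix_of_sign_ne (mem_block.mpr hx) (mem_block.mpr hy) hz]
        have : ((x, z₁) : OracleReg N) ≠ (y, z₂) := fun h => hz (congrArg Prod.snd h)
        simp [this, hk]
  · obtain ⟨h2', hS', -⟩ := hV t ht
    set m' : ℝ := ((block V t).card : ℝ) with hmdef'
    have hm' : (2 : ℝ) ≤ m' := by rw [hmdef']; exact_mod_cast h2'
    -- Different sides: a constant block, the product of two means of modulus at most `√η`.
    refine ⟨((((block V s).card : ℂ)⁻¹ * blockSum V s) *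
        (((block V t).card : ℂ)⁻¹ * star (blockSum V t))) • Matrix.of (fun _ _ => 1),
        (SchurBound.const_one.smul _).mono ?_, ?_⟩
    · rw [norm_mul, norm_mul, norm_mul, norm_inv, norm_inv, norm_star, Complex.norm_natCast,
        Complex.norm_natCast, ← hmdef, ← hmdef']
      have sm : ∀ (t : Bool) (m : ℝ), 2 ≤ m → (‖blockSum V t‖ + 1) ^ 2 ≤ η * m ^ 2 →
          (m⁻¹ * ‖blockSum V t‖) ^ 2 ≤ η := by
        intro t m hm h
        rw [mul_pow, inv_pow, inv_mul_le_iff₀ (by positivity), mul_comm]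
        exact (pow_le_pow_left₀ (norm_nonneg _) (by linarith) 2).trans h
      have e1 := sm s m hm2 hS
      have e2 := sm t m' hm' hS'
      nlinarith [sq_nonneg (m⁻¹ * ‖blockSum V s‖ - m'⁻¹ * ‖blockSum V t‖)]
    · rintro ⟨x, z₁⟩ ⟨y, z₂⟩ hp hq
      obtain ⟨rfl, hx⟩ := Prod.ext_iff.mp hp
      obtain ⟨rfl, hy⟩ := Prod.ext_iff.mp hq
      dsimp only at hx hy
      rw [Matrix.sub_apply, queryMatrix_of_ne_block hst (mem_block.mpr hx) (mem_block.mpr hy)]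
      have : ((x, z₁) : OracleReg N) ≠ (y, z₂) := fun h => by
        rw [Prod.mk.injEq] at h
        exact hst (by rw [← hx, ← hy, h.1])
      simp [this]

/-! ### Phase sums, balance and query bounds -/

theorem sum_chi {N : ℕ} (hN : 2 ≤ N) : ∑ a : Fin N, chi a = 0 := by
  have h : IsPrimitiveRoot (omega N) N := Complex.isPrimitiveRoot_exp N (by omega)
  have := h.geom_sum_eq_zero (by omega)
  rwa [← Fin.sum_univ_eq_sum_range fun i => omega N ^ i] at this

theorem block_true {N : ℕ} (V : Finset (Fin N)) : block V true = V := by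
  ext x; simp [mem_block]

theorem block_false {N : ℕ} (V : Finset (Fin N)) : block V false = Vᶜ := by
  ext x; simp [mem_block]

theorem norm_blockSum {N : ℕ} (hN : 2 ≤ N) (V : Finset (Fin N)) (s : Bool) :
    ‖blockSum V s‖ = ‖∑ a ∈ V, chi a‖ := by
  cases s with
  | true => rw [blockSum, block_true]
  | false =>
    have := Finset.sum_add_sum_compl V (chi (N := N))
    rw [sum_chi hN] at this
    rw [blockSum, block_false, ← norm_neg, neg_eq_of_add_eq_zero_left this]

theorem Balanced.empty {N : ℕ} (hN : 2 ≤ N) {η : ℝ} (h : 1 ≤ η * N) :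
    Balanced (∅ : Finset (Fin N)) η := by
  have hN' : (1 : ℝ) ≤ N := by exact_mod_cast (by omega : 1 ≤ N)
  intro s hs
  cases s with
  | true => simp [block_true] at hs
  | false =>
    rw [norm_blockSum hN, block_false]
    simp only [Finset.compl_empty, Finset.card_univ, Fintype.card_fin, Finset.sum_empty, norm_zero,
      zero_add, one_pow]
    exact ⟨hN, by nlinarith, h⟩

/-- The complement is at least as large as `V` and its phase sum has the same modulus, so only `V`
has to be controlled. -/
theorem Balanced.of_norm_sum_le {N : ℕ} {V : Finset (Fin N)} (h2 : 2 ≤ V.card)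
    (hN : 2 * V.card ≤ N) (hS : ‖∑ a ∈ V, chi a‖ ^ 2 ≤ V.card * √V.card) :
    Balanced V (4 / √V.card) := by
  have hv : (2 : ℝ) ≤ V.card := by exact_mod_cast h2
  have hr : √(V.card : ℝ) ^ 2 = V.card := Real.sq_sqrt (by positivity)
  have hr1 : 1 ≤ √(V.card : ℝ) := Real.one_le_sqrt.mpr (by linarith)
  intro s _
  have hm : V.card ≤ (block V s).card := by
    cases s with
    | true => rw [block_true]
    | false => rw [block_false, Finset.card_compl, Fintype.card_fin]; omega
  have hm' : (V.card : ℝ) ≤ (block V s).card := by exact_mod_cast hm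
  refine ⟨h2.trans hm, ?_, ?_⟩
  · rw [norm_blockSum (by omega)]
    calc (‖∑ a ∈ V, chi a‖ + 1) ^ 2 ≤ 2 * ‖∑ a ∈ V, chi a‖ ^ 2 + 2 := by
          nlinarith [sq_nonneg (‖∑ a ∈ V, chi a‖ - 1)]
      _ ≤ 4 * (V.card * √V.card) := by nlinarith
      _ = 4 / √V.card * V.card ^ 2 := by
          field_simp
          nlinarith
      _ ≤ 4 / √V.card * (block V s).card ^ 2 := by gcongr
  · calc (1 : ℝ) ≤ 4 * √V.card := by linarith
      _ = 4 / √V.card * V.card := by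
          field_simp
          nlinarith
      _ ≤ 4 / √V.card * (block V s).card := by gcongr

/-- Both query matrices are within `768 η` of the identity, hence within `1536 η` of each other. -/
theorem Balanced.needsQueries {N w : ℕ} {V : Finset (Fin N)} {η b : ℝ} (hη : 0 ≤ η)
    (hV : Balanced V η) (h0 : Balanced (∅ : Finset (Fin N)) η) (hb : 0 ≤ b)
    (hbη : 1536 * η * b ≤ 1) : NeedsQueries w V b := by
  intro d A ρ hρ _ _
  have hs : SchurBound (queryMatrix (stabilizing V) - queryMatrix (stabilizing ∅))
      (1536 * η) := by
    have := (hV.schurBound hη).sub (h0.schurBound hη)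
    rw [sub_sub_sub_cancel_right] at this
    exact this.mono (by linarith)
  have := abs_acceptProb_sub_le A (stabilizing_nonempty V) (stabilizing_nonempty ∅) hs hρ
  have hq : (0 : ℝ) ≤ A.queries := by positivity
  nlinarith [mul_le_mul_of_nonneg_right this hb, mul_le_mul_of_nonneg_left hbη hq]

theorem needsQueries_of_norm_sum_le {N w : ℕ} {V : Finset (Fin N)} (h2 : 2 ≤ V.card)
    (hN : 2 * V.card ≤ N) (hS : ‖∑ a ∈ V, chi a‖ ^ 2 ≤ V.card * √V.card) {b : ℝ} (hb : 0 ≤ b)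
    (hbv : b ≤ √V.card / 6144) : NeedsQueries w V b := by
  have hv : (2 : ℝ) ≤ V.card := by exact_mod_cast h2
  have hr : √(V.card : ℝ) ^ 2 = V.card := Real.sq_sqrt (by positivity)
  have hr1 : 1 ≤ √(V.card : ℝ) := Real.one_le_sqrt.mpr (by linarith)
  have hN' : (V.card : ℝ) ≤ N := by exact_mod_cast (by omega : V.card ≤ N)
  refine (Balanced.of_norm_sum_le h2 hN hS).needsQueries (by positivity)
    (Balanced.empty (by omega) ?_) hb ?_
  · rw [div_mul_eq_mul_div, le_div_iff₀ (by positivity)]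
    nlinarith
  · have : 1536 * (4 / √V.card) * b = 6144 * b / √V.card := by ring
    rw [this, div_le_one (by positivity)]
    linarith

/-! ### The phase sum of a random subset -/

theorem card_powersetCard_mem_mem {N m : ℕ} (hm : 2 ≤ m) (x y : Fin N) :
    ((Finset.univ.powersetCard m).filter fun V => x ∈ V ∧ y ∈ V).card =
      if x = y then (N - 1).choose (m - 1) else (N - 2).choose (m - 2) := by
  have h : ∀ V : Finset (Fin N), (x ∈ V ∧ y ∈ V) ↔ {x, y} ⊆ V := by
    intro V; simp [Finset.insert_subset_iff]
  have hc : ({x, y} : Finset (Fin N)).card ≤ m := Finset.card_le_two.trans hm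
  simp only [h]
  rw [Finset.card_filter_powersetCard_subset _ _ _ (Finset.subset_univ _) hc, Finset.card_univ,
    Fintype.card_fin]
  split_ifs with hxy
  · simp [hxy]
  · rw [Finset.card_pair hxy]

/-- In the expanded square, the number of `V` containing `x` and `y` depends only on whether `x =
y`. The part constant in `x`, `y` vanishes because the phases sum to zero; only a diagonal
contribution remains. -/
theorem sum_norm_sq_sum_chi_le {N m : ℕ} (hN : 2 ≤ N) (hm : 2 ≤ m) :
    ∑ V ∈ (Finset.univ : Finset (Fin N)).powersetCard m, ‖∑ a ∈ V, chi a‖ ^ 2 ≤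
      m * (N.choose m : ℝ) := by
  have key : ∑ V ∈ (Finset.univ : Finset (Fin N)).powersetCard m,
      ((‖∑ a ∈ V, chi a‖ ^ 2 : ℝ) : ℂ) =
      N * (((N - 1).choose (m - 1) : ℂ) - (N - 2).choose (m - 2)) := by
    have h1 : ∀ V : Finset (Fin N), ((‖∑ a ∈ V, chi a‖ ^ 2 : ℝ) : ℂ) =
        ∑ x, ∑ y, if x ∈ V ∧ y ∈ V then chi x * star (chi y) else 0 := by
      intro V
      push_cast
      rw [← Complex.mul_conj', ← Complex.star_def, star_sum, Finset.sum_mul_sum]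
      simp only [ite_and, Finset.sum_ite_mem, Finset.univ_inter, Finset.sum_ite_irrel,
        Finset.sum_const_zero]
    simp only [h1]
    rw [Finset.sum_comm]
    have h2 : ∀ x y : Fin N, (∑ V ∈ (Finset.univ : Finset (Fin N)).powersetCard m,
        if x ∈ V ∧ y ∈ V then chi x * star (chi y) else 0) =
        ((N - 2).choose (m - 2) : ℂ) * (chi x * star (chi y)) +
          if x = y then (((N - 1).choose (m - 1) : ℂ) - (N - 2).choose (m - 2)) else 0 := by
      intro x y
      rw [← Finset.sum_filter, Finset.sum_const, card_powersetCard_mem_mem hm, nsmul_eq_mul]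
      split_ifs with h
      · subst h
        rw [chi_mul_star]; ring
      · ring
    rw [Finset.sum_congr rfl fun x _ =>
      Finset.sum_comm.trans (Finset.sum_congr rfl fun y _ => h2 x y)]
    simp only [Finset.sum_add_distrib, ← Finset.mul_sum, ← Finset.sum_mul, sum_chi hN]
    simp
    ring
  have key' : ∑ V ∈ (Finset.univ : Finset (Fin N)).powersetCard m, ‖∑ a ∈ V, chi a‖ ^ 2 =
      N * (((N - 1).choose (m - 1) : ℝ) - (N - 2).choose (m - 2)) := by
    exact_mod_cast key
  have h3 : N * (N - 1).choose (m - 1) = N.choose m * m := by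
    obtain ⟨k, rfl⟩ := Nat.exists_eq_add_of_le' (by omega : 1 ≤ N)
    obtain ⟨l, rfl⟩ := Nat.exists_eq_add_of_le' (by omega : 1 ≤ m)
    exact Nat.add_one_mul_choose_eq k l
  have h4 : (N : ℝ) * (N - 1).choose (m - 1) = N.choose m * m := by exact_mod_cast h3
  rw [key', mul_sub, h4, mul_comm]
  have : (0 : ℝ) ≤ N * ((N - 2).choose (m - 2) : ℕ) := by positivity
  linarith

open Classical in
theorem hardFraction_le_one (N w m : ℕ) (b : ℝ) : hardFraction N w m b ≤ 1 := by
  rw [hardFraction]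
  refine div_le_one_of_le₀ ?_ (by positivity)
  exact Nat.cast_le.mpr (Finset.card_filter_le _ _)

open Classical in
theorem one_sub_le_hardFraction {N m : ℕ} (w : ℕ) (hm : 2 ≤ m) (hN : 2 * m ≤ N) {b : ℝ}
    (hb : 0 ≤ b) (hbm : b ≤ √m / 6144) : 1 - 1 / √m ≤ hardFraction N w m b := by
  have hm' : (2 : ℝ) ≤ m := by exact_mod_cast hm
  have hr1 : 1 ≤ √(m : ℝ) := Real.one_le_sqrt.mpr (by linarith)
  set P := (Finset.univ : Finset (Fin N)).powersetCard m with hP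
  have hPc : (P.card : ℝ) = N.choose m := by simp [hP]
  have hP0 : (0 : ℝ) < P.card := by
    rw [hPc]; exact_mod_cast Nat.choose_pos (by omega)
  set bad := P.filter fun V => ¬ NeedsQueries w V b with hbad
  -- Markov's inequality: every bad `V` has `|S|^2 ≥ m√m`, while the mean of `|S|^2` is at most `m`.
  have h1 : (bad.card : ℝ) * (m * √m) ≤ m * P.card := by
    rw [hPc]
    refine le_trans ?_ (sum_norm_sq_sum_chi_le (by omega) hm)
    rw [← nsmul_eq_mul]
    refine (Finset.card_nsmul_le_sum bad _ _ fun V hV => ?_).trans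
      (Finset.sum_le_sum_of_subset_of_nonneg (Finset.filter_subset _ _)
        fun _ _ _ => by positivity)
    rw [hbad, Finset.mem_filter, hP, Finset.mem_powersetCard] at hV
    obtain ⟨⟨-, rfl⟩, hV⟩ := hV
    by_contra h
    exact hV (needsQueries_of_norm_sum_le hm hN (not_le.mp h).le hb hbm)
  have h2 : ((P.filter fun V => NeedsQueries w V b).card : ℝ) + bad.card = P.card := by
    exact_mod_cast Finset.card_filter_add_card_filter_not _
  have h3 : (bad.card : ℝ) ≤ P.card / √m := by
    rw [le_div_iff₀ (by positivity)]
    nlinarith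
  rw [hardFraction]
  have h4 : 1 - 1 / √(m : ℝ) ≤ ((P.filter fun V => NeedsQueries w V b).card : ℝ) / P.card := by
    rw [le_div_iff₀ hP0, sub_mul, one_mul, one_div_mul_eq_div]
    linarith
  convert h4

open Classical in
theorem Verifier.not_decides {N w m : ℕ} (hm : 2 ≤ m) (hN : 2 * m ≤ N) (P : Verifier N w m)
    {ε : ℝ} (h : P.alg.queries < ε * (√m / 6144)) : ¬ P.Decides ε := by
  have hm' : (2 : ℝ) ≤ m := by exact_mod_cast hm
  have hr1 : 1 < √(m : ℝ) := Real.lt_sqrt_of_sq_lt (by linarith)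
  have h1 := one_sub_le_hardFraction w hm hN (b := √m / 6144) (by positivity) le_rfl
  have h2 : 0 < hardFraction N w m (√m / 6144) := by
    refine lt_of_lt_of_le ?_ h1
    rw [sub_pos, div_lt_one (by positivity)]
    exact hr1
  obtain ⟨V, hV⟩ : (((Finset.univ : Finset (Fin N)).powersetCard m).filter
      fun V => NeedsQueries w V (√m / 6144)).Nonempty := by
    rw [Finset.nonempty_iff_ne_empty]
    intro h0
    rw [hardFraction] at h2
    apply h2.ne'
    rw [div_eq_zero_iff]
    left
    rw [Nat.cast_eq_zero, Finset.card_eq_zero]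
    convert h0
  rw [Finset.mem_filter, Finset.mem_powersetCard] at hV
  intro hd
  obtain ⟨ρ, hρ, hacc⟩ := hd V hV.1.2
  have hq := hV.2 P.d P.alg ρ (P.isDensity ρ hρ) (P.yes_entangles V hV.1.2 ρ hρ)
    (P.no_entangles ρ hρ)
  -- The gap holds against every admissible starting state on the NO instance, in particular against
  -- the YES witness itself.
  have hle : ε ≤ |P.alg.acceptProb (stabilizing V) ρ - P.alg.acceptProb (stabilizing ∅) ρ| :=
    (by linarith [hacc ρ hρ] : ε ≤ _).trans (le_abs_self _)
  have := mul_le_mul_of_nonneg_right hle (by positivity : 0 ≤ √(m : ℝ) / 6144)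
  linarith

/-! ### Asymptotics in `n` -/

section asymptotics

open Filter

variable {α : ℝ} {v : ℕ → ℕ}

theorem tendsto_two_pow : Tendsto (fun n : ℕ => (2 : ℝ) ^ n) atTop atTop :=
  tendsto_pow_atTop_atTop_of_one_lt one_lt_two

theorem tendsto_two_pow_rpow (hα0 : 0 < α) :
    Tendsto (fun n : ℕ => ((2 : ℝ) ^ n) ^ α) atTop atTop :=
  (tendsto_rpow_atTop hα0).comp tendsto_two_pow

theorem tendsto_size (hα0 : 0 < α) (hv : ∀ n, |(v n : ℝ) - ((2 : ℝ) ^ n) ^ α| < 1) :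
    Tendsto (fun n => (v n : ℝ)) atTop atTop := by
  refine tendsto_atTop_mono (fun n => ?_) (tendsto_atTop_add_const_right _ (-1)
    (tendsto_two_pow_rpow hα0))
  linarith [(abs_lt.mp (hv n)).1]

theorem eventually_two_le_size (hα0 : 0 < α) (hv : ∀ n, |(v n : ℝ) - ((2 : ℝ) ^ n) ^ α| < 1) :
    ∀ᶠ n in atTop, 2 ≤ v n := by
  filter_upwards [(tendsto_size hα0 hv).eventually_ge_atTop 2] with n hn
  exact_mod_cast hn

theorem eventually_two_mul_size_le (hα1 : α < 1 / 2)
    (hv : ∀ n, |(v n : ℝ) - ((2 : ℝ) ^ n) ^ α| < 1) : ∀ᶠ n in atTop, 2 * v n ≤ 2 ^ n := by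
  filter_upwards [tendsto_two_pow.eventually_ge_atTop 16] with n hn
  have h1 : ((2 : ℝ) ^ n) ^ α ≤ √((2 : ℝ) ^ n) := by
    rw [Real.sqrt_eq_rpow]
    exact Real.rpow_le_rpow_of_exponent_le (by linarith) hα1.le
  have h2 : √((2 : ℝ) ^ n) ^ 2 = 2 ^ n := Real.sq_sqrt (by positivity)
  have h3 : 4 ≤ √((2 : ℝ) ^ n) := Real.le_sqrt_of_sq_le (by linarith)
  have : (2 : ℝ) * v n ≤ 2 ^ n := by nlinarith [(abs_lt.mp (hv n)).2]
  exact_mod_cast this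

theorem eventually_rpow_le_sqrt_size (hα0 : 0 < α)
    (hv : ∀ n, |(v n : ℝ) - ((2 : ℝ) ^ n) ^ α| < 1) :
    ∀ᶠ n in atTop, 1 / 12288 * ((2 : ℝ) ^ n) ^ (α / 2) ≤ √(v n) / 6144 := by
  filter_upwards [(tendsto_two_pow_rpow hα0).eventually_ge_atTop 2] with n hn
  -- Rounding costs less than 1, so `v n ≥ N^α - 1 ≥ N^α / 4`; the resulting factor 2 makes `12288 =
  -- 2 * 6144`.
  have h1 : ((2 : ℝ) ^ n) ^ (α / 2) / 2 ≤ √(v n) := by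
    refine Real.le_sqrt_of_sq_le ?_
    have : (((2 : ℝ) ^ n) ^ (α / 2)) ^ 2 = ((2 : ℝ) ^ n) ^ α := by
      rw [← Real.rpow_natCast, ← Real.rpow_mul (by positivity)]
      norm_num
    rw [div_pow, this]
    linarith [(abs_lt.mp (hv n)).1]
  linarith

theorem eval_le_eval_one_mul_pow (p : Polynomial ℕ) {n : ℕ} (hn : 1 ≤ n) :
    p.eval n ≤ p.eval 1 * n ^ p.natDegree := by
  rw [Polynomial.eval_eq_sum_range, Polynomial.eval_eq_sum_range, Finset.sum_mul]
  refine Finset.sum_le_sum fun i hi => ?_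
  rw [one_pow, mul_one]
  exact Nat.mul_le_mul_left _ (Nat.pow_le_pow_right hn (by
    have := Finset.mem_range.mp hi; omega))

theorem eval_pos_of_ne_zero {q : Polynomial ℕ} (hq : q ≠ 0) {n : ℕ} (hn : 1 ≤ n) :
    0 < q.eval n := by
  rw [Polynomial.eval_eq_sum_range]
  refine Finset.sum_pos' (fun _ _ => Nat.zero_le _)
    ⟨q.natDegree, Finset.self_mem_range_succ _, ?_⟩
  exact Nat.mul_pos (Nat.pos_of_ne_zero (Polynomial.leadingCoeff_ne_zero.mpr hq)) (Nat.pow_pos hn)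

/-- Exponentials eventually exceed polynomials. -/
theorem eventually_eval_lt_rpow {β c : ℝ} (hβ : 0 < β) (hc : 0 < c) (p : Polynomial ℕ) :
    ∀ᶠ n : ℕ in atTop, ((p.eval n : ℕ) : ℝ) < c * ((2 : ℝ) ^ n) ^ β := by
  have hr : 1 < (2 : ℝ) ^ β := Real.one_lt_rpow one_lt_two hβ
  have h := (tendsto_pow_const_div_const_pow_of_one_lt p.natDegree hr).const_mul
    ((p.eval 1 : ℕ) : ℝ)
  rw [mul_zero] at h
  filter_upwards [h.eventually_lt_const hc, eventually_ge_atTop 1] with n hn h1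
  have e : ((2 : ℝ) ^ n) ^ β = ((2 : ℝ) ^ β) ^ n := by
    rw [← Real.rpow_natCast, ← Real.rpow_natCast, ← Real.rpow_mul zero_le_two,
      ← Real.rpow_mul zero_le_two, mul_comm]
  rw [← mul_div_assoc, div_lt_iff₀ (by positivity)] at hn
  rw [e]
  refine lt_of_le_of_lt ?_ hn
  exact_mod_cast eval_le_eval_one_mul_pow p h1

end asymptotics

end PhaseOracle
end

theorem mainTheorem2 (α : ℝ) (hα0 : 0 < α) (hα1 : α < 1 / 2) :
    (∃ c : ℝ, 0 < c ∧ ∀ w v : ℕ → ℕ,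
      (fun n => (w n : ℝ)) =o[Filter.atTop] (fun n => (n : ℝ)) →
      (∀ n, |(v n : ℝ) - ((2 : ℝ) ^ n) ^ α| < 1) →
      Filter.Tendsto
        (fun n => PhaseOracle.hardFraction (2 ^ n) (w n) (v n)
          (c * min (((2 : ℝ) ^ n) ^ (α / 4)) (((2 : ℝ) ^ n) ^ (1 / 2 - α))))
        Filter.atTop (nhds 1)) ∧
    (∀ w v : ℕ → ℕ,
      (fun n => (w n : ℝ)) =o[Filter.atTop] (fun n => (n : ℝ)) →
      (∀ n, |(v n : ℝ) - ((2 : ℝ) ^ n) ^ α| < 1) →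
      ∀ p q : Polynomial ℕ, q ≠ 0 →
        ∀ᶠ n in Filter.atTop, ∀ P : PhaseOracle.Verifier (2 ^ n) (w n) (v n),
          P.alg.queries ≤ p.eval n → ¬ P.Decides (1 / ((q.eval n : ℕ) : ℝ))) := by
  refine ⟨⟨1 / 12288, by norm_num, fun w v _ hv => ?_⟩, fun w v _ hv p q hq => ?_⟩
  · have hlim : Filter.Tendsto (fun n => 1 - 1 / √(v n : ℝ)) Filter.atTop (nhds 1) := by
      have := ((Real.tendsto_sqrt_atTop.comp
        (PhaseOracle.tendsto_size hα0 hv)).inv_tendsto_atTop).const_sub 1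
      simpa using this
    refine tendsto_of_tendsto_of_tendsto_of_le_of_le' hlim tendsto_const_nhds ?_
      (Filter.Eventually.of_forall fun n => PhaseOracle.hardFraction_le_one _ _ _ _)
    filter_upwards [PhaseOracle.eventually_two_le_size hα0 hv,
      PhaseOracle.eventually_two_mul_size_le hα1 hv,
      PhaseOracle.eventually_rpow_le_sqrt_size hα0 hv] with n h2 hN hb
    refine PhaseOracle.one_sub_le_hardFraction (w n) h2 hN (by positivity) (le_trans ?_ hb)
    -- The bound obtained has order `N^(α/2)`, which dominates `N^(α/4)` and so the minimum.
    refine mul_le_mul_of_nonneg_left ((min_le_left _ _).trans ?_) (by norm_num)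
    exact Real.rpow_le_rpow_of_exponent_le (one_le_pow₀ one_le_two) (by linarith)
  · filter_upwards [PhaseOracle.eventually_two_le_size hα0 hv,
      PhaseOracle.eventually_two_mul_size_le hα1 hv,
      PhaseOracle.eventually_rpow_le_sqrt_size hα0 hv,
      -- With gap `1/q`, at most `p` queries are too few once `p * q` is below the exponential
      -- bound.
      PhaseOracle.eventually_eval_lt_rpow (half_pos hα0)
        (by norm_num : (0 : ℝ) < 1 / 12288) (p * q),
      Filter.eventually_ge_atTop 1] with n h2 hN hb hpq hn P hP
    have hq0 : (0 : ℝ) < ((q.eval n : ℕ) : ℝ) := by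
      exact_mod_cast PhaseOracle.eval_pos_of_ne_zero hq hn
    refine P.not_decides h2 hN ?_
    rw [one_div, ← div_eq_inv_mul, lt_div_iff₀ hq0]
    have hP' : (P.alg.queries : ℝ) ≤ ((p.eval n : ℕ) : ℝ) := by exact_mod_cast hP
    rw [Polynomial.eval_mul, Nat.cast_mul] at hpq
    calc (P.alg.queries : ℝ) * ((q.eval n : ℕ) : ℝ)
        ≤ ((p.eval n : ℕ) : ℝ) * ((q.eval n : ℕ) : ℝ) := mul_le_mul_of_nonneg_right hP' hq0.le
      _ < _ := hpq.trans_le hb
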